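/- Let $\mathcal H_A,\mathcal H_B$ be finite-dimensional complex Hilbert spaces with fixed reference orthonormal bases, and use the product basis on $\mathcal H_A\otimes\mathcal H_B$. For a state $\rho$ (positive semidefinite, trace one) on $\mathcal H_A\otimes\mathcal H_B$ let $\rho^{T_A}$ be its partial transpose on $A$, let $\mathcal N(\rho)=\operatorname{tr}|\rho^{T_A}|-1$ be its negativity, where $|X|=(X^\dagger X)^{1/2}$, and let $C_{l_1}(\rho)=\sum_{j\neq k}|\rho_{jk}|$ be its $l_1$-norm of coherence in the product basis. Call $\rho$ a pairing state if $\mathcal N(\rho)=C_{l_1}(U\rho U^\dagger)$ for some local unitary $U=U_A\otimes U_B$. A PPT operation is a completely positive trace-preserving linear map $\Psi$ from operators on a bipartite system $AB$ to operators on a bipartite system $A'B'$ such that the map $X\mapsto\Psi(X^{T_A})^{T_{A'}}$ is also completely positive. Let $\Phi_d=\frac1d\sum_{i,k=1}^d|ii\rangle\langle kk|$ be the maximally entangled state on $\mathbb C^d\otimes\mathbb C^d$. The asymptotic exact PPT entanglement cost $E_{\mathrm{PPT}}(\rho)$ is the infimum of all real $r$ such that, for all sufficiently large $n$, there are an integer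 $d\ge1$ with $\log_2 d\le rn$ and a PPT operation $\Psi$ with $\Psi(\Phi_d)=\rho^{\otimes n}$, where $\rho^{\otimes n}$ is regarded as a bipartite state across the cut $A^n:B^n$ (and $E_{\mathrm{PPT}}(\rho)=+\infty$ if there is no such $r$). Theorem. For every pairing state $\rho$ on $\mathcal H_A\otimes\mathcal H_B$, the asymptotic exact PPT entanglement cost equals the logarithmic negativity: $$E_{\mathrm{PPT}}(\rho)=\log_2\bigl(1+\mathcal N(\rho)\bigr).$$ -/

import Mathlib

open scoped ComplexOrder MatrixOrder Kronecker

/-! A bipartite operator on `ℋ_A ⊗ ℋ_B` (finite-dimensional, with reference orthonormal bases indexed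
by `a` and `b`) is its matrix in the product basis, indexed by `a × b`. -/

namespace PairingState

noncomputable section

/-- A quantum state: a positive semidefinite matrix of trace one. -/
structure IsState {ι : Type*} [Fintype ι] (ρ : Matrix ι ι ℂ) : Prop where
  posSemidef : ρ.PosSemidef
  trace_eq_one : ρ.trace = 1

/-- The partial transpose `X ↦ X^{T_A}` with respect to the first subsystem. -/
def partialTranspose (a b : Type*) :
    Matrix (a × b) (a × b) ℂ →ₗ[ℂ] Matrix (a × b) (a × b) ℂ where
  toFun X := Matrix.of fun p q => X (q.1, p.2) (p.1, q.2)
  map_add' _ _ := rfl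
  map_smul' _ _ := rfl

/-- The trace norm `‖X‖₁ = tr |X|`, where `|X| = (X† X)^{1/2}`. -/
def traceNorm {ι : Type*} [Fintype ι] [DecidableEq ι] (X : Matrix ι ι ℂ) : ℝ :=
  (CFC.abs X).trace.re

/-- The `l₁`-norm of coherence: the sum of the moduli of the off-diagonal entries. -/
def coherenceL1 {ι : Type*} [Fintype ι] [DecidableEq ι] (ρ : Matrix ι ι ℂ) : ℝ :=
  ∑ i, ∑ j, if i = j then 0 else ‖ρ i j‖

section Bipartite

variable {a b : Type*} [Fintype a] [DecidableEq a] [Fintype b] [DecidableEq b]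

/-- The negativity `𝒩(ρ) = ‖ρ^{T_A}‖₁ - 1`. -/
def negativity (ρ : Matrix (a × b) (a × b) ℂ) : ℝ :=
  traceNorm (partialTranspose a b ρ) - 1

/-- The logarithmic negativity `𝒩_L(ρ) = log₂ (1 + 𝒩(ρ))`. -/
def logNegativity (ρ : Matrix (a × b) (a × b) ℂ) : ℝ :=
  Real.logb 2 (1 + negativity ρ)

/-- A pairing state: a bipartite state `ρ` with `𝒩(ρ) = C_{l₁}(U ρ U†)` for some local unitary
`U = U_A ⊗ U_B`. -/
def IsPairingState (ρ : Matrix (a × b) (a × b) ℂ) : Prop :=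
  IsState ρ ∧ ∃ UA ∈ Matrix.unitaryGroup a ℂ, ∃ UB ∈ Matrix.unitaryGroup b ℂ,
    negativity ρ = coherenceL1 ((UA ⊗ₖ UB) * ρ * (UA ⊗ₖ UB).conjTranspose)

/-- The `n`-fold tensor power `ρ^{⊗ n}`, as a bipartite operator for the cut `A^n : B^n`. -/
def tensorPower (ρ : Matrix (a × b) (a × b) ℂ) (n : ℕ) :
    Matrix ((Fin n → a) × (Fin n → b)) ((Fin n → a) × (Fin n → b)) ℂ :=
  Matrix.of fun p q => ∏ i, ρ (p.1 i, p.2 i) (q.1 i, q.2 i)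

end Bipartite

/-- The maximally entangled state `Φ_d = d⁻¹ ∑_{i,k} |ii⟩⟨kk|` on `ℂ^d ⊗ ℂ^d`. -/
def maxEntangled (d : ℕ) : Matrix (Fin d × Fin d) (Fin d × Fin d) ℂ :=
  Matrix.of fun p q => if p.1 = p.2 ∧ q.1 = q.2 then (d : ℂ)⁻¹ else 0

/-- Complete positivity of a linear map `Ψ` between matrix algebras: `id_k ⊗ Ψ` (that is, `Ψ` applied
to each block of a `k × k` block matrix) preserves positive semidefiniteness for every `k`. -/
def IsCompletelyPositive {ι κ : Type*} (Ψ : Matrix ι ι ℂ →ₗ[ℂ] Matrix κ κ ℂ) : Prop :=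
  ∀ (k : ℕ) (M : Matrix (Fin k × ι) (Fin k × ι) ℂ), M.PosSemidef →
    (Matrix.of fun p q : Fin k × κ =>
      Ψ (Matrix.of fun x y => M (p.1, x) (q.1, y)) p.2 q.2).PosSemidef

/-- A PPT operation from `A B` to `A' B'`: a completely positive trace-preserving map `Ψ` such that
`T_{A'} ∘ Ψ ∘ T_A` is completely positive as well. -/
structure IsPPTOperation {a b a' b' : Type*} [Fintype a] [Fintype b] [Fintype a'] [Fintype b']
    (Ψ : Matrix (a × b) (a × b) ℂ →ₗ[ℂ] Matrix (a' × b') (a' × b') ℂ) : Prop where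
  completelyPositive : IsCompletelyPositive Ψ
  tracePreserving : ∀ X, (Ψ X).trace = X.trace
  ppt : IsCompletelyPositive (partialTranspose a' b' ∘ₗ Ψ ∘ₗ partialTranspose a b)

section Cost

variable {a b : Type*} [Fintype a] [DecidableEq a] [Fintype b] [DecidableEq b]

/-- The rate `r` (in ebits per copy) is achievable for the exact preparation of `ρ`: for all
sufficiently large `n`, a PPT operation converts some `Φ_d` with `log₂ d ≤ r n` exactly into
`ρ^{⊗ n}`. -/
def IsAchievableRate (ρ : Matrix (a × b) (a × b) ℂ) (r : ℝ) : Prop :=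
  ∀ᶠ n : ℕ in Filter.atTop, ∃ d : ℕ, 0 < d ∧ Real.logb 2 d ≤ r * n ∧
    ∃ Ψ : Matrix (Fin d × Fin d) (Fin d × Fin d) ℂ →ₗ[ℂ]
        Matrix ((Fin n → a) × (Fin n → b)) ((Fin n → a) × (Fin n → b)) ℂ,
      IsPPTOperation Ψ ∧ Ψ (maxEntangled d) = tensorPower ρ n

/-- The asymptotic exact PPT entanglement cost: the infimum of the achievable rates (taken in the
extended reals, so that it would be `⊤` if no rate were achievable). -/
def exactPPTCost (ρ : Matrix (a × b) (a × b) ℂ) : EReal :=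
  sInf ((fun r : ℝ => (r : EReal)) '' {r : ℝ | IsAchievableRate ρ r})

end Cost

end

end PairingState

/-!
Every PPT operation is, after conjugation with partial transposes, positive and trace preserving,
so it does not increase `‖X^{T_A}‖₁`. For `Φ_d` this quantity is `d` and it is multiplicative under
tensor powers, which bounds the cost from below by the logarithmic negativity.

Conversely, measure `{Φ_d, 1 - Φ_d}` and prepare `σ` on the first outcome and `τ` on the second.
Since `Φ_d^{T_A}` is `d⁻¹` times the swap `F`, whose spectral projections are `(1 ± F) / 2`, this is
a PPT operation as soon as `-(d - 1) τ^{T_A} ≤ σ^{T_A} ≤ (d + 1) τ^{T_A}`. If the binegativity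
`|σ^{T_A}|^{T_A}` is positive semidefinite, then normalizing it to trace one gives such a `τ`
whenever `d ≥ ‖σ^{T_A}‖₁ + 1`, and the bound is attained asymptotically.

For a pairing state written in the right local bases, `‖ρ^{T_A}‖₁` equals the sum of the moduli of
all entries of `ρ^{T_A}`. Writing `|ρ^{T_A}| = ρ^{T_A} W` with `W` unitary, equality in the
entrywise estimate of `tr (ρ^{T_A} W)` forces `|ρ^{T_A}|` to be diagonal. It is then its own partial
transpose, so the binegativity is positive semidefinite.
-/

namespace PairingState

section Matrices

variable {𝕜 ι κ : Type*} [RCLike 𝕜] [Fintype ι]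

theorem trace_mul_nonneg {P Q : Matrix ι ι 𝕜} (hP : P.PosSemidef) (hQ : Q.PosSemidef) :
    0 ≤ (P * Q).trace := by
  classical
  obtain ⟨B, rfl⟩ := CStarAlgebra.nonneg_iff_eq_star_mul_self.1 hQ.nonneg
  rw [← mul_assoc, Matrix.trace_mul_comm, ← mul_assoc]
  exact (hP.mul_mul_conjTranspose_same B).trace_nonneg

theorem posSemidef_trace_mul_blocks [Finite κ] {E : Matrix ι ι 𝕜} (hE : E.PosSemidef)
    {M : Matrix (κ × ι) (κ × ι) 𝕜} (hM : M.PosSemidef) :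
    (Matrix.of fun p q => (E * Matrix.of fun x y => M (p, x) (q, y)).trace).PosSemidef := by
  classical
  have := Fintype.ofFinite κ
  obtain ⟨B, rfl⟩ := CStarAlgebra.nonneg_iff_eq_star_mul_self.1 hE.nonneg
  set N := ((1 : Matrix κ κ 𝕜) ⊗ₖ B) * M * ((1 : Matrix κ κ 𝕜) ⊗ₖ B).conjTranspose with hN
  have hblocks : (Matrix.of fun p q =>
      (star B * B * Matrix.of fun x y => M (p, x) (q, y)).trace)
        = ∑ i, N.submatrix (fun p => (p, i)) (fun p => (p, i)) := by
    ext p q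
    rw [Matrix.of_apply, mul_assoc, Matrix.trace_mul_comm, Matrix.sum_apply]
    simp [hN, Matrix.trace, Matrix.mul_apply, Fintype.sum_prod_type, Matrix.one_apply, apply_ite]
  rw [hblocks]
  exact Matrix.posSemidef_sum _ fun i _ => (hM.mul_mul_conjTranspose_same _).submatrix _

variable [DecidableEq ι]

theorem posSemidef_one_add_of_mul_self_eq_one {W : Matrix ι ι 𝕜} (hW : W.IsHermitian)
    (hWW : W * W = 1) : (1 + W).PosSemidef := by
  have h : 1 + W = (2⁻¹ : 𝕜) • ((1 + W).conjTranspose * (1 + W)) := by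
    rw [Matrix.conjTranspose_add, hW.eq, Matrix.conjTranspose_one, mul_add, add_mul, add_mul, hWW]
    simp only [one_mul, mul_one]
    module
  rw [h]
  exact (Matrix.posSemidef_conjTranspose_mul_self _).smul (inv_nonneg.2 zero_le_two)

theorem posSemidef_one_sub_of_mul_self_eq_one {W : Matrix ι ι 𝕜} (hW : W.IsHermitian)
    (hWW : W * W = 1) : (1 - W).PosSemidef := by
  rw [sub_eq_add_neg]
  exact posSemidef_one_add_of_mul_self_eq_one hW.neg (by rw [neg_mul_neg, hWW])

theorem trace_unitary_conj {X V : Matrix ι ι 𝕜} (hV : V ∈ Matrix.unitaryGroup ι 𝕜) :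
    (V * X * V.conjTranspose).trace = X.trace := by
  rw [Matrix.trace_mul_comm, ← mul_assoc, ← Matrix.star_eq_conjTranspose,
    Matrix.mem_unitaryGroup_iff'.1 hV, one_mul]

theorem sum_norm_sq_row_of_mem_unitaryGroup {W : Matrix ι ι 𝕜}
    (hW : W ∈ Matrix.unitaryGroup ι 𝕜) (i : ι) : ∑ k, ‖W i k‖ ^ 2 = 1 := by
  have h := congrFun (congrFun (Matrix.mem_unitaryGroup_iff.1 hW) i) i
  simp only [Matrix.mul_apply, Matrix.star_apply, RCLike.star_def, RCLike.mul_conj,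
    Matrix.one_apply_eq] at h
  exact_mod_cast h

theorem apply_eq_zero_of_mem_unitaryGroup {W : Matrix ι ι 𝕜} (hW : W ∈ Matrix.unitaryGroup ι 𝕜)
    {i j k : ι} (hij : 1 ≤ ‖W i j‖) (hjk : j ≠ k) : W i k = 0 := by
  have hpair : ‖W i j‖ ^ 2 + ‖W i k‖ ^ 2 ≤ 1 := by
    rw [← sum_norm_sq_row_of_mem_unitaryGroup hW i,
      ← Finset.sum_pair (f := fun k => ‖W i k‖ ^ 2) hjk]
    exact Finset.sum_le_sum_of_subset_of_nonneg (Finset.subset_univ _) fun _ _ _ => by positivity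
  have hsq : ‖W i k‖ ^ 2 ≤ 0 := by nlinarith
  simpa using hsq.antisymm (by positivity)

theorem re_mul_eq_norm_of_re_trace_mul_eq {X W : Matrix ι ι 𝕜}
    (hW : W ∈ Matrix.unitaryGroup ι 𝕜)
    (h : RCLike.re (X * W).trace = ∑ i, ∑ j, ‖X i j‖) (i j : ι) :
    RCLike.re (X i j * W j i) = ‖X i j‖ := by
  have hle : ∀ i j, RCLike.re (X i j * W j i) ≤ ‖X i j‖ := fun i j =>
    (RCLike.re_le_norm _).trans <| by
      rw [norm_mul]
      exact mul_le_of_le_one_right (norm_nonneg _) (entry_norm_bound_of_unitary hW _ _)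
  have hsum : ∑ i, ∑ j, RCLike.re (X i j * W j i) = ∑ i, ∑ j, ‖X i j‖ := by
    simpa only [Matrix.trace, Matrix.diag_apply, Matrix.mul_apply, map_sum] using h
  have hrow := (Finset.sum_eq_sum_iff_of_le
    fun i _ => Finset.sum_le_sum fun j _ => hle i j).1 hsum i (Finset.mem_univ i)
  exact (Finset.sum_eq_sum_iff_of_le fun j _ => hle i j).1 hrow j (Finset.mem_univ j)

theorem isDiag_mul_of_re_trace_mul_eq {X W : Matrix ι ι 𝕜} (hW : W ∈ Matrix.unitaryGroup ι 𝕜)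
    (h : RCLike.re (X * W).trace = ∑ i, ∑ j, ‖X i j‖) : (X * W).IsDiag := by
  intro i k hik
  rw [Matrix.mul_apply]
  refine Finset.sum_eq_zero fun j _ => ?_
  obtain hX | hX := eq_or_ne (X i j) 0
  · rw [hX, zero_mul]
  have hWji : 1 ≤ ‖W j i‖ := by
    have hre := RCLike.re_le_norm (X i j * W j i)
    rw [re_mul_eq_norm_of_re_trace_mul_eq hW h, norm_mul] at hre
    exact (le_mul_iff_one_le_right (norm_pos_iff.2 hX)).1 hre
  rw [apply_eq_zero_of_mem_unitaryGroup hW hWji hik, mul_zero]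

end Matrices

section TraceNorm

variable {ι κ : Type*} [Fintype ι] [DecidableEq ι] [Fintype κ] [DecidableEq κ]

theorem abs_eq_of_mul_self_eq {X P : Matrix ι ι ℂ} (hP : P.PosSemidef)
    (h : P * P = X.conjTranspose * X) : CFC.abs X = P :=
  CFC.sqrt_unique h hP.nonneg

theorem posSemidef_abs (X : Matrix ι ι ℂ) : (CFC.abs X).PosSemidef :=
  Matrix.nonneg_iff_posSemidef.1 (CFC.abs_nonneg X)

theorem abs_unitary_conj {X V : Matrix ι ι ℂ} (hV : V ∈ Matrix.unitaryGroup ι ℂ) :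
    CFC.abs (V * X * V.conjTranspose) = V * CFC.abs X * V.conjTranspose := by
  have hVV : V.conjTranspose * V = 1 := Matrix.mem_unitaryGroup_iff'.1 hV
  have hmul (A B : Matrix ι ι ℂ) : V * A * V.conjTranspose * (V * B * V.conjTranspose)
      = V * (A * B) * V.conjTranspose := by
    calc _ = V * A * (V.conjTranspose * V) * B * V.conjTranspose := by simp only [mul_assoc]
      _ = _ := by rw [hVV]; simp only [mul_assoc, one_mul]
  refine abs_eq_of_mul_self_eq ((posSemidef_abs X).mul_mul_conjTranspose_same V) ?_
  rw [hmul, Matrix.conjTranspose_mul, Matrix.conjTranspose_mul, Matrix.conjTranspose_conjTranspose,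
    ← mul_assoc V X.conjTranspose, hmul, CFC.abs_mul_abs, Matrix.star_eq_conjTranspose]

theorem exists_isHermitian_mul_self_eq_one_abs_eq_mul {X : Matrix ι ι ℂ} (hX : X.IsHermitian) :
    ∃ W : Matrix ι ι ℂ, W.IsHermitian ∧ W * W = 1 ∧ CFC.abs X = X * W := by
  have hX' : IsSelfAdjoint X := hX
  have hcont (f : ℝ → ℝ) : ContinuousOn f (spectrum ℝ X) :=
    Matrix.finite_real_spectrum.continuousOn f
  -- The sign function takes the value `1` at `0`, so that it squares to `1` everywhere.
  refine ⟨cfc (fun x : ℝ => if x < 0 then (-1 : ℝ) else 1) X, cfc_predicate (R := ℝ) _ X, ?_, ?_⟩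
  · rw [← cfc_mul _ _ X (hcont _) (hcont _), ← cfc_one ℝ X]
    congr 1
    ext x
    split_ifs <;> simp
  · rw [CFC.abs_eq_cfc_norm X]
    conv_rhs => enter [1]; rw [← cfc_id ℝ X]
    rw [← cfc_mul _ _ X (hcont _) (hcont _)]
    congr 1
    ext x
    split_ifs with hx
    · simp [abs_of_neg hx]
    · simp [abs_of_nonneg (not_lt.1 hx)]

theorem isDiag_abs_of_traceNorm_eq {X : Matrix ι ι ℂ} (hX : X.IsHermitian)
    (h : traceNorm X = ∑ i, ∑ j, ‖X i j‖) : (CFC.abs X).IsDiag := by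
  obtain ⟨W, hW, hWW, habs⟩ := exists_isHermitian_mul_self_eq_one_abs_eq_mul hX
  have hWu : W ∈ Matrix.unitaryGroup ι ℂ := by
    rwa [Matrix.mem_unitaryGroup_iff, Matrix.star_eq_conjTranspose, hW.eq]
  rw [traceNorm, habs] at h
  rw [habs]
  exact isDiag_mul_of_re_trace_mul_eq hWu h

theorem posSemidef_smul_abs_add {X : Matrix ι ι ℂ} (hX : X.IsHermitian) {c : ℝ} (hc : 1 ≤ c) :
    (c • CFC.abs X + X).PosSemidef := by
  have hX' : IsSelfAdjoint X := hX
  have hpos : (CFC.abs X + X).PosSemidef := by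
    rw [CFC.abs_add_self X]
    exact Matrix.nonneg_iff_posSemidef.1 (nsmul_nonneg (CFC.posPart_nonneg X) 2)
  have hsplit : c • CFC.abs X + X = (c - 1) • CFC.abs X + (CFC.abs X + X) := by module
  rw [hsplit]
  exact ((posSemidef_abs X).smul (sub_nonneg.2 hc)).add hpos

theorem posSemidef_smul_abs_sub {X : Matrix ι ι ℂ} (hX : X.IsHermitian) {c : ℝ} (hc : 1 ≤ c) :
    (c • CFC.abs X - X).PosSemidef := by
  simpa only [CFC.abs_neg, ← sub_eq_add_neg] using posSemidef_smul_abs_add hX.neg hc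

theorem ofReal_traceNorm (X : Matrix ι ι ℂ) : (traceNorm X : ℂ) = (CFC.abs X).trace :=
  (Complex.eq_re_of_ofReal_le (r := 0) (posSemidef_abs X).trace_nonneg).symm

theorem re_trace_le_traceNorm {X : Matrix ι ι ℂ} (hX : X.IsHermitian) :
    X.trace.re ≤ traceNorm X := by
  have h := (Complex.nonneg_iff.1 (posSemidef_smul_abs_sub hX le_rfl).trace_nonneg).1
  rw [one_smul, Matrix.trace_sub, Complex.sub_re] at h
  exact sub_nonneg.1 h

theorem traceNorm_unitary_conj {X V : Matrix ι ι ℂ} (hV : V ∈ Matrix.unitaryGroup ι ℂ) :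
    traceNorm (V * X * V.conjTranspose) = traceNorm X := by
  rw [traceNorm, abs_unitary_conj hV, trace_unitary_conj hV, traceNorm]

theorem re_trace_mul_le_re_trace {P W : Matrix ι ι ℂ} (hP : P.PosSemidef) (hW : W.IsHermitian)
    (hWW : W * W = 1) : (P * W).trace.re ≤ P.trace.re := by
  have h := trace_mul_nonneg hP (posSemidef_one_sub_of_mul_self_eq_one hW hWW)
  rw [mul_sub, mul_one, Matrix.trace_sub] at h
  exact (Complex.le_def.1 (sub_nonneg.1 h)).1

theorem traceNorm_sub_le {P Q : Matrix ι ι ℂ} (hP : P.PosSemidef) (hQ : Q.PosSemidef) :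
    traceNorm (P - Q) ≤ P.trace.re + Q.trace.re := by
  obtain ⟨W, hW, hWW, habs⟩ :=
    exists_isHermitian_mul_self_eq_one_abs_eq_mul (hP.isHermitian.sub hQ.isHermitian)
  calc traceNorm (P - Q) = (P * W).trace.re + (Q * -W).trace.re := by
        rw [traceNorm, habs, sub_mul, mul_neg, Matrix.trace_sub, Matrix.trace_neg, Complex.sub_re,
          Complex.neg_re, sub_eq_add_neg]
    _ ≤ P.trace.re + Q.trace.re :=
        add_le_add (re_trace_mul_le_re_trace hP hW hWW)
          (re_trace_mul_le_re_trace hQ hW.neg (by rw [neg_mul_neg, hWW]))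

theorem traceNorm_map_le {Λ : Matrix ι ι ℂ →ₗ[ℂ] Matrix κ κ ℂ}
    (hpos : ∀ X, X.PosSemidef → (Λ X).PosSemidef) (htr : ∀ X, (Λ X).trace = X.trace)
    {X : Matrix ι ι ℂ} (hX : X.IsHermitian) : traceNorm (Λ X) ≤ traceNorm X := by
  have hX' : IsSelfAdjoint X := hX
  calc traceNorm (Λ X) = traceNorm (Λ X⁺ - Λ X⁻) := by
        rw [← map_sub, CFC.posPart_sub_negPart X]
    _ ≤ (Λ X⁺).trace.re + (Λ X⁻).trace.re :=
        traceNorm_sub_le (hpos _ (Matrix.nonneg_iff_posSemidef.1 (CFC.posPart_nonneg X)))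
          (hpos _ (Matrix.nonneg_iff_posSemidef.1 (CFC.negPart_nonneg X)))
    _ = traceNorm X := by
        rw [htr, htr, ← Complex.add_re, ← Matrix.trace_add, CFC.posPart_add_negPart X, traceNorm]

end TraceNorm

section States

variable {ι : Type*} [Fintype ι] [DecidableEq ι] {ρ : Matrix ι ι ℂ}

theorem IsState.unitary_conj (hρ : IsState ρ) {U : Matrix ι ι ℂ}
    (hU : U ∈ Matrix.unitaryGroup ι ℂ) : IsState (U * ρ * U.conjTranspose) :=
  ⟨hρ.posSemidef.mul_mul_conjTranspose_same U,
    (trace_unitary_conj hU).trans hρ.trace_eq_one⟩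

theorem IsState.sum_norm_apply_eq (hρ : IsState ρ) :
    ∑ i, ∑ j, ‖ρ i j‖ = 1 + coherenceL1 ρ := by
  have hdiag : ∑ i, ‖ρ i i‖ = 1 := by
    have h : ((∑ i, ‖ρ i i‖ : ℝ) : ℂ) = 1 := by
      rw [← hρ.trace_eq_one, Matrix.trace, Complex.ofReal_sum]
      exact Finset.sum_congr rfl fun i _ => Complex.norm_of_nonneg' hρ.posSemidef.diag_nonneg
    exact_mod_cast h
  rw [← hdiag, coherenceL1, ← Finset.sum_add_distrib]
  refine Finset.sum_congr rfl fun i _ => ?_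
  calc ∑ j, ‖ρ i j‖ = ∑ j, ((if i = j then ‖ρ i j‖ else 0) + if i = j then 0 else ‖ρ i j‖) :=
        Finset.sum_congr rfl fun j _ => by split_ifs <;> simp
    _ = ‖ρ i i‖ + ∑ j, if i = j then 0 else ‖ρ i j‖ := by simp [Finset.sum_add_distrib]

end States

section TensorPower

variable {a b : Type*}

theorem conjTranspose_tensorPower (M : Matrix (a × b) (a × b) ℂ) (n : ℕ) :
    (tensorPower M n).conjTranspose = tensorPower M.conjTranspose n := by
  ext p q
  simp [tensorPower, Matrix.conjTranspose_apply]

section Fintype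

variable [Fintype a] [Fintype b]

theorem prod_sum_eq_sum_prod_pair {R : Type*} [CommSemiring R] {n : ℕ} (f : Fin n → a × b → R) :
    ∏ i, ∑ x, f i x = ∑ p : (Fin n → a) × (Fin n → b), ∏ i, f i (p.1 i, p.2 i) := by
  rw [Finset.prod_univ_sum, Fintype.piFinset_univ]
  exact Fintype.sum_equiv (Equiv.arrowProdEquivProdArrow (Fin n) (fun _ => a) (fun _ => b)) _ _
    fun _ => rfl

theorem tensorPower_mul (M N : Matrix (a × b) (a × b) ℂ) (n : ℕ) :
    tensorPower (M * N) n = tensorPower M n * tensorPower N n := by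
  ext p q
  simp only [tensorPower, Matrix.of_apply, Matrix.mul_apply, prod_sum_eq_sum_prod_pair,
    Finset.prod_mul_distrib]

theorem trace_tensorPower (M : Matrix (a × b) (a × b) ℂ) (n : ℕ) :
    (tensorPower M n).trace = M.trace ^ n := by
  simp only [Matrix.trace, Matrix.diag_apply, tensorPower, Matrix.of_apply]
  rw [← prod_sum_eq_sum_prod_pair fun _ x => M x x, Finset.prod_const, Finset.card_univ,
    Fintype.card_fin]

end Fintype

theorem posSemidef_tensorPower [Finite a] [Finite b] {M : Matrix (a × b) (a × b) ℂ}
    (hM : M.PosSemidef) (n : ℕ) : (tensorPower M n).PosSemidef := by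
  classical
  have := Fintype.ofFinite a
  have := Fintype.ofFinite b
  obtain ⟨B, rfl⟩ := CStarAlgebra.nonneg_iff_eq_star_mul_self.1 hM.nonneg
  rw [Matrix.star_eq_conjTranspose, tensorPower_mul, ← conjTranspose_tensorPower]
  exact Matrix.posSemidef_conjTranspose_mul_self _

theorem IsState.tensorPower [Fintype a] [Fintype b] {ρ : Matrix (a × b) (a × b) ℂ}
    (hρ : IsState ρ) (n : ℕ) : IsState (tensorPower ρ n) :=
  ⟨posSemidef_tensorPower hρ.posSemidef n, by rw [trace_tensorPower, hρ.trace_eq_one, one_pow]⟩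

variable [Fintype a] [Fintype b] [DecidableEq a] [DecidableEq b]

theorem abs_tensorPower (M : Matrix (a × b) (a × b) ℂ) (n : ℕ) :
    CFC.abs (tensorPower M n) = tensorPower (CFC.abs M) n := by
  refine abs_eq_of_mul_self_eq (posSemidef_tensorPower (posSemidef_abs M) n) ?_
  rw [← tensorPower_mul, CFC.abs_mul_abs, Matrix.star_eq_conjTranspose, conjTranspose_tensorPower,
    ← tensorPower_mul]

theorem traceNorm_tensorPower (M : Matrix (a × b) (a × b) ℂ) (n : ℕ) :
    traceNorm (tensorPower M n) = traceNorm M ^ n := by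
  have h : (traceNorm (tensorPower M n) : ℂ) = (traceNorm M : ℂ) ^ n := by
    rw [ofReal_traceNorm, abs_tensorPower, trace_tensorPower, ofReal_traceNorm]
  exact_mod_cast h

end TensorPower

section PartialTranspose

variable {a b : Type*}

theorem partialTranspose_apply (X : Matrix (a × b) (a × b) ℂ) (p q : a × b) :
    partialTranspose a b X p q = X (q.1, p.2) (p.1, q.2) := rfl

theorem partialTranspose_partialTranspose (X : Matrix (a × b) (a × b) ℂ) :
    partialTranspose a b (partialTranspose a b X) = X := rfl

theorem partialTranspose_tensorPower (X : Matrix (a × b) (a × b) ℂ) (n : ℕ) :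
    partialTranspose (Fin n → a) (Fin n → b) (tensorPower X n)
      = tensorPower (partialTranspose a b X) n := rfl

theorem partialTranspose_eq_self_of_isDiag {X : Matrix (a × b) (a × b) ℂ} (hX : X.IsDiag) :
    partialTranspose a b X = X := by
  ext p q
  obtain rfl | hpq := eq_or_ne p q
  · rfl
  · have hswap : (q.1, p.2) ≠ (p.1, q.2) := fun h =>
      hpq (Prod.ext (Prod.ext_iff.1 h).1.symm (Prod.ext_iff.1 h).2)
    rw [partialTranspose_apply, hX hpq, hX hswap]

theorem partialTranspose_one [DecidableEq a] [DecidableEq b] : partialTranspose a b 1 = 1 :=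
  partialTranspose_eq_self_of_isDiag Matrix.isDiag_one

theorem isHermitian_partialTranspose {X : Matrix (a × b) (a × b) ℂ} (hX : X.IsHermitian) :
    (partialTranspose a b X).IsHermitian :=
  Matrix.IsHermitian.ext fun _ _ => hX.apply _ _

variable [Fintype a] [Fintype b]

theorem trace_partialTranspose (X : Matrix (a × b) (a × b) ℂ) :
    (partialTranspose a b X).trace = X.trace := rfl

theorem sum_sum_swap_fst {M : Type*} [AddCommMonoid M] (f : a × b → a × b → M) :
    ∑ p : a × b, ∑ q : a × b, f (q.1, p.2) (p.1, q.2) = ∑ p, ∑ q, f p q := by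
  rw [← Fintype.sum_prod_type', ← Fintype.sum_prod_type']
  exact Finset.sum_nbij' (fun x => ((x.2.1, x.1.2), (x.1.1, x.2.2)))
    (fun x => ((x.2.1, x.1.2), (x.1.1, x.2.2))) (by simp) (by simp) (by simp) (by simp) (by simp)

theorem trace_mul_partialTranspose (X Y : Matrix (a × b) (a × b) ℂ) :
    (X * partialTranspose a b Y).trace = (partialTranspose a b X * Y).trace := by
  simp only [Matrix.trace, Matrix.diag_apply, Matrix.mul_apply, partialTranspose_apply]
  rw [← sum_sum_swap_fst]

theorem sum_norm_partialTranspose (X : Matrix (a × b) (a × b) ℂ) :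
    ∑ i, ∑ j, ‖partialTranspose a b X i j‖ = ∑ i, ∑ j, ‖X i j‖ :=
  sum_sum_swap_fst fun p q => ‖X p q‖

theorem partialTranspose_kronecker_mul_mul (R S : Matrix a a ℂ) (T U : Matrix b b ℂ)
    (X : Matrix (a × b) (a × b) ℂ) :
    partialTranspose a b ((R ⊗ₖ T) * X * (S ⊗ₖ U))
      = (S.transpose ⊗ₖ T) * partialTranspose a b X * (R.transpose ⊗ₖ U) := by
  ext p q
  simp only [partialTranspose_apply, Matrix.mul_apply, Matrix.kroneckerMap_apply, Finset.sum_mul]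
  rw [← sum_sum_swap_fst]
  refine Finset.sum_congr rfl fun x _ => Finset.sum_congr rfl fun y _ => ?_
  simp only [Matrix.transpose_apply]
  ring

theorem partialTranspose_local_conj (R : Matrix a a ℂ) (T : Matrix b b ℂ)
    (X : Matrix (a × b) (a × b) ℂ) :
    partialTranspose a b ((R ⊗ₖ T) * X * (R ⊗ₖ T).conjTranspose)
      = (R.map star ⊗ₖ T) * partialTranspose a b X * (R.map star ⊗ₖ T).conjTranspose := by
  simp only [Matrix.conjTranspose_kronecker, partialTranspose_kronecker_mul_mul]
  congr 2
  ext i j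
  simp

end PartialTranspose

section Binegativity

variable {a b : Type*} [Fintype a] [DecidableEq a] [Fintype b] [DecidableEq b]
  {ρ : Matrix (a × b) (a × b) ℂ}

/-- The binegativity `|ρ^{T_A}|^{T_A}` of a bipartite operator. -/
noncomputable def binegativity (ρ : Matrix (a × b) (a × b) ℂ) : Matrix (a × b) (a × b) ℂ :=
  partialTranspose a b (CFC.abs (partialTranspose a b ρ))

theorem trace_binegativity (ρ : Matrix (a × b) (a × b) ℂ) :
    (binegativity ρ).trace = (traceNorm (partialTranspose a b ρ) : ℂ) := by
  rw [binegativity, trace_partialTranspose, ofReal_traceNorm]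

theorem binegativity_tensorPower (ρ : Matrix (a × b) (a × b) ℂ) (n : ℕ) :
    binegativity (tensorPower ρ n) = tensorPower (binegativity ρ) n := by
  rw [binegativity, partialTranspose_tensorPower, abs_tensorPower, partialTranspose_tensorPower,
    binegativity]

theorem map_star_kronecker_mem_unitaryGroup {UA : Matrix a a ℂ} {UB : Matrix b b ℂ}
    (hUA : UA ∈ Matrix.unitaryGroup a ℂ) (hUB : UB ∈ Matrix.unitaryGroup b ℂ) :
    UA.map star ⊗ₖ UB ∈ Matrix.unitaryGroup (a × b) ℂ :=
  Matrix.kronecker_mem_unitary (Matrix.map_star_mem_unitaryGroup_iff.2 hUA) hUB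

theorem binegativity_local_unitary_conj {UA : Matrix a a ℂ} {UB : Matrix b b ℂ}
    (hUA : UA ∈ Matrix.unitaryGroup a ℂ) (hUB : UB ∈ Matrix.unitaryGroup b ℂ)
    (ρ : Matrix (a × b) (a × b) ℂ) :
    binegativity ((UA ⊗ₖ UB) * ρ * (UA ⊗ₖ UB).conjTranspose)
      = (UA ⊗ₖ UB) * binegativity ρ * (UA ⊗ₖ UB).conjTranspose := by
  have hstar : (UA.map star).map star = UA := by
    ext i j
    simp
  rw [binegativity, partialTranspose_local_conj,
    abs_unitary_conj (map_star_kronecker_mem_unitaryGroup hUA hUB), partialTranspose_local_conj,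
    hstar, binegativity]

theorem negativity_local_unitary_conj {UA : Matrix a a ℂ} {UB : Matrix b b ℂ}
    (hUA : UA ∈ Matrix.unitaryGroup a ℂ) (hUB : UB ∈ Matrix.unitaryGroup b ℂ)
    (ρ : Matrix (a × b) (a × b) ℂ) :
    negativity ((UA ⊗ₖ UB) * ρ * (UA ⊗ₖ UB).conjTranspose) = negativity ρ := by
  rw [negativity, partialTranspose_local_conj,
    traceNorm_unitary_conj (map_star_kronecker_mem_unitaryGroup hUA hUB), negativity]

theorem posSemidef_binegativity_of_negativity_eq_coherenceL1 (hρ : IsState ρ)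
    (h : negativity ρ = coherenceL1 ρ) : (binegativity ρ).PosSemidef := by
  have hnorm : traceNorm (partialTranspose a b ρ) = ∑ i, ∑ j, ‖partialTranspose a b ρ i j‖ := by
    rw [sum_norm_partialTranspose, hρ.sum_norm_apply_eq, ← h, negativity, add_sub_cancel]
  have hdiag : (CFC.abs (partialTranspose a b ρ)).IsDiag :=
    isDiag_abs_of_traceNorm_eq (isHermitian_partialTranspose hρ.posSemidef.isHermitian) hnorm
  rw [binegativity, partialTranspose_eq_self_of_isDiag hdiag]
  exact posSemidef_abs _

theorem IsPairingState.posSemidef_binegativity (hρ : IsPairingState ρ) :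
    (binegativity ρ).PosSemidef := by
  obtain ⟨hstate, UA, hUA, UB, hUB, h⟩ := hρ
  have hU : UA ⊗ₖ UB ∈ Matrix.unitaryGroup (a × b) ℂ := Matrix.kronecker_mem_unitary hUA hUB
  have hconj := posSemidef_binegativity_of_negativity_eq_coherenceL1 (hstate.unitary_conj hU)
    ((negativity_local_unitary_conj hUA hUB ρ).trans h)
  rw [binegativity_local_unitary_conj hUA hUB] at hconj
  exact (Matrix.IsUnit.posSemidef_star_right_conjugate_iff (Unitary.isUnit_coe (U := ⟨_, hU⟩))).1
    hconj

end Binegativity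

section CompletelyPositive

variable {ι κ : Type*}

theorem IsCompletelyPositive.add {Ψ Ψ' : Matrix ι ι ℂ →ₗ[ℂ] Matrix κ κ ℂ}
    (h : IsCompletelyPositive Ψ) (h' : IsCompletelyPositive Ψ') :
    IsCompletelyPositive (Ψ + Ψ') := fun k M hM => (h k M hM).add (h' k M hM)

theorem IsCompletelyPositive.map_posSemidef {Ψ : Matrix ι ι ℂ →ₗ[ℂ] Matrix κ κ ℂ}
    (h : IsCompletelyPositive Ψ) {X : Matrix ι ι ℂ} (hX : X.PosSemidef) : (Ψ X).PosSemidef :=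
  (h 1 (X.submatrix Prod.snd Prod.snd) (hX.submatrix _)).submatrix (fun i => (0, i))

variable [Fintype ι]

/-- The map `X ↦ tr (E X) σ`, which prepares `σ` with the probability of the effect `E`. -/
def measurePrepare (E : Matrix ι ι ℂ) (σ : Matrix κ κ ℂ) : Matrix ι ι ℂ →ₗ[ℂ] Matrix κ κ ℂ :=
  (Matrix.traceLinearMap ι ℂ ℂ ∘ₗ LinearMap.mulLeft ℂ E).smulRight σ

theorem measurePrepare_apply (E X : Matrix ι ι ℂ) (σ : Matrix κ κ ℂ) :
    measurePrepare E σ X = (E * X).trace • σ := rfl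

theorem isCompletelyPositive_measurePrepare [Finite κ] {E : Matrix ι ι ℂ} {σ : Matrix κ κ ℂ}
    (hE : E.PosSemidef) (hσ : σ.PosSemidef) : IsCompletelyPositive (measurePrepare E σ) := by
  have := Fintype.ofFinite κ
  exact fun k M hM => (posSemidef_trace_mul_blocks hE hM).kronecker hσ

theorem partialTranspose_comp_measurePrepare {a b a' b' : Type*} [Fintype a] [Fintype b]
    (E : Matrix (a × b) (a × b) ℂ) (σ : Matrix (a' × b') (a' × b') ℂ) :
    partialTranspose a' b' ∘ₗ measurePrepare E σ ∘ₗ partialTranspose a b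
      = measurePrepare (partialTranspose a b E) (partialTranspose a' b' σ) := by
  refine LinearMap.ext fun X => ?_
  simp only [LinearMap.comp_apply, measurePrepare_apply, map_smul, trace_mul_partialTranspose]

end CompletelyPositive

section MaxEntangled

variable {d : ℕ}

theorem isHermitian_maxEntangled (d : ℕ) : (maxEntangled d).IsHermitian := by
  refine Matrix.IsHermitian.ext fun p q => ?_
  simp [maxEntangled, apply_ite star, and_comm]

theorem maxEntangled_mul_self (hd : 0 < d) : maxEntangled d * maxEntangled d = maxEntangled d := by
  ext p q
  simp only [maxEntangled, Matrix.mul_apply, Matrix.of_apply, Fintype.sum_prod_type]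
  by_cases hp : p.1 = p.2 <;> by_cases hq : q.1 = q.2 <;> simp [hp, hq, hd.ne']

theorem trace_maxEntangled (hd : 0 < d) : (maxEntangled d).trace = 1 := by
  simp [maxEntangled, Matrix.trace, Fintype.sum_prod_type, hd.ne']

theorem isStarProjection_maxEntangled (hd : 0 < d) : IsStarProjection (maxEntangled d) :=
  ⟨maxEntangled_mul_self hd, isHermitian_maxEntangled d⟩

theorem posSemidef_maxEntangled (hd : 0 < d) : (maxEntangled d).PosSemidef :=
  Matrix.nonneg_iff_posSemidef.1 (isStarProjection_maxEntangled hd).nonneg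

theorem posSemidef_one_sub_maxEntangled (hd : 0 < d) : (1 - maxEntangled d).PosSemidef :=
  Matrix.nonneg_iff_posSemidef.1 (isStarProjection_maxEntangled hd).one_sub.nonneg

/-- The swap operator `x ⊗ y ↦ y ⊗ x`. -/
def swapMatrix (ι : Type*) [DecidableEq ι] : Matrix (ι × ι) (ι × ι) ℂ :=
  Equiv.Perm.permMatrix ℂ (Equiv.prodComm ι ι)

theorem swapMatrix_mul_self (ι : Type*) [Fintype ι] [DecidableEq ι] :
    swapMatrix ι * swapMatrix ι = 1 := by
  rw [swapMatrix, ← Matrix.permMatrix_mul]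
  exact Matrix.permMatrix_one

theorem isHermitian_swapMatrix (ι : Type*) [DecidableEq ι] : (swapMatrix ι).IsHermitian :=
  Matrix.conjTranspose_permMatrix _

theorem partialTranspose_maxEntangled (d : ℕ) :
    partialTranspose (Fin d) (Fin d) (maxEntangled d) = (d : ℝ)⁻¹ • swapMatrix (Fin d) := by
  ext p q
  simp [partialTranspose_apply, maxEntangled, swapMatrix, Equiv.Perm.permMatrix,
    PEquiv.toMatrix_apply, Prod.ext_iff, eq_comm, and_comm]

theorem traceNorm_partialTranspose_maxEntangled (d : ℕ) :
    traceNorm (partialTranspose (Fin d) (Fin d) (maxEntangled d)) = d := by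
  have habs : CFC.abs (partialTranspose (Fin d) (Fin d) (maxEntangled d)) = (d : ℝ)⁻¹ • 1 := by
    refine abs_eq_of_mul_self_eq (Matrix.PosSemidef.one.smul (by positivity)) ?_
    rw [partialTranspose_maxEntangled, Matrix.conjTranspose_smul, (isHermitian_swapMatrix _).eq,
      star_trivial, smul_mul_smul_comm, smul_mul_smul_comm, swapMatrix_mul_self, mul_one]
  simp [traceNorm, habs, Matrix.trace_smul, Matrix.trace_one, ← mul_assoc, inv_mul_mul_self]

end MaxEntangled

section LowerBound

variable {a b a' b' : Type*} [Fintype a] [DecidableEq a] [Fintype b] [DecidableEq b]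
  [Fintype a'] [DecidableEq a'] [Fintype b'] [DecidableEq b']

theorem IsPPTOperation.traceNorm_partialTranspose_map_le
    {Ψ : Matrix (a × b) (a × b) ℂ →ₗ[ℂ] Matrix (a' × b') (a' × b') ℂ} (hΨ : IsPPTOperation Ψ)
    {X : Matrix (a × b) (a × b) ℂ} (hX : X.IsHermitian) :
    traceNorm (partialTranspose a' b' (Ψ X)) ≤ traceNorm (partialTranspose a b X) := by
  set Λ := partialTranspose a' b' ∘ₗ Ψ ∘ₗ partialTranspose a b with hΛ
  have htr (Y : Matrix (a × b) (a × b) ℂ) : (Λ Y).trace = Y.trace := by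
    rw [hΛ, LinearMap.comp_apply, LinearMap.comp_apply, trace_partialTranspose,
      hΨ.tracePreserving, trace_partialTranspose]
  calc traceNorm (partialTranspose a' b' (Ψ X)) = traceNorm (Λ (partialTranspose a b X)) := by
        rw [hΛ, LinearMap.comp_apply, LinearMap.comp_apply, partialTranspose_partialTranspose]
    _ ≤ traceNorm (partialTranspose a b X) :=
        traceNorm_map_le (fun _ => hΨ.ppt.map_posSemidef) htr (isHermitian_partialTranspose hX)

variable {ρ : Matrix (a × b) (a × b) ℂ}

theorem IsState.one_le_traceNorm_partialTranspose (hρ : IsState ρ) :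
    1 ≤ traceNorm (partialTranspose a b ρ) := by
  have h := re_trace_le_traceNorm (isHermitian_partialTranspose hρ.posSemidef.isHermitian)
  rwa [trace_partialTranspose, hρ.trace_eq_one, Complex.one_re] at h

theorem logNegativity_eq_logb_traceNorm (ρ : Matrix (a × b) (a × b) ℂ) :
    logNegativity ρ = Real.logb 2 (traceNorm (partialTranspose a b ρ)) := by
  rw [logNegativity, negativity, add_sub_cancel]

theorem IsState.logNegativity_le_of_isAchievableRate (hρ : IsState ρ) {r : ℝ}
    (hr : IsAchievableRate ρ r) : logNegativity ρ ≤ r := by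
  obtain ⟨n, ⟨d, -, hdr, Ψ, hΨ, hΨρ⟩, hn⟩ := (hr.and (Filter.eventually_gt_atTop 0)).exists
  have hle : traceNorm (partialTranspose a b ρ) ^ n ≤ d := by
    rw [← traceNorm_tensorPower, ← partialTranspose_tensorPower, ← hΨρ,
      ← traceNorm_partialTranspose_maxEntangled d]
    exact hΨ.traceNorm_partialTranspose_map_le (isHermitian_maxEntangled d)
  have hpos : 0 < traceNorm (partialTranspose a b ρ) :=
    zero_lt_one.trans_le hρ.one_le_traceNorm_partialTranspose
  have hlog : n * logNegativity ρ ≤ n * r := by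
    calc n * logNegativity ρ = Real.logb 2 (traceNorm (partialTranspose a b ρ) ^ n) := by
          rw [logNegativity_eq_logb_traceNorm, Real.logb_pow]
      _ ≤ Real.logb 2 d := Real.logb_le_logb_of_le one_lt_two (pow_pos hpos n) hle
      _ ≤ n * r := hdr.trans_eq (mul_comm r n)
  exact le_of_mul_le_mul_left hlog (Nat.cast_pos.2 hn)

end LowerBound

section UpperBound

variable {a b : Type*} {d : ℕ} {σ τ ρ : Matrix (a × b) (a × b) ℂ}

/-- The channel that tests for the maximally entangled state `Φ_d` and prepares `σ` if the test
succeeds and `τ` if it fails. -/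
noncomputable def testAndPrepare (d : ℕ) (σ τ : Matrix (a × b) (a × b) ℂ) :
    Matrix (Fin d × Fin d) (Fin d × Fin d) ℂ →ₗ[ℂ] Matrix (a × b) (a × b) ℂ :=
  measurePrepare (maxEntangled d) σ + measurePrepare (1 - maxEntangled d) τ

theorem testAndPrepare_maxEntangled (hd : 0 < d) (σ τ : Matrix (a × b) (a × b) ℂ) :
    testAndPrepare d σ τ (maxEntangled d) = σ := by
  rw [testAndPrepare, LinearMap.add_apply, measurePrepare_apply, measurePrepare_apply, sub_mul,
    one_mul, maxEntangled_mul_self hd, sub_self, trace_maxEntangled hd, Matrix.trace_zero, one_smul,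
    zero_smul, add_zero]

theorem partialTranspose_comp_testAndPrepare (hd : 0 < d) (σ τ : Matrix (a × b) (a × b) ℂ) :
    partialTranspose a b ∘ₗ testAndPrepare d σ τ ∘ₗ partialTranspose (Fin d) (Fin d)
      = measurePrepare (1 + swapMatrix (Fin d)) ((2 * d : ℝ)⁻¹ •
          (((d : ℝ) - 1) • partialTranspose a b τ + partialTranspose a b σ))
        + measurePrepare (1 - swapMatrix (Fin d)) ((2 * d : ℝ)⁻¹ •
          (((d : ℝ) + 1) • partialTranspose a b τ - partialTranspose a b σ)) := by
  have hd' : (d : ℂ) ≠ 0 := Nat.cast_ne_zero.2 hd.ne'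
  rw [testAndPrepare, LinearMap.add_comp, LinearMap.comp_add, partialTranspose_comp_measurePrepare,
    partialTranspose_comp_measurePrepare, map_sub, partialTranspose_one,
    partialTranspose_maxEntangled]
  refine LinearMap.ext fun Y => ?_
  simp only [LinearMap.add_apply, measurePrepare_apply, add_mul, sub_mul, Matrix.smul_mul,
    Matrix.trace_add, Matrix.trace_sub, Matrix.trace_smul, one_mul, ← Complex.coe_smul, smul_eq_mul]
  push_cast
  match_scalars <;> field_simp <;> ring

variable [Fintype a] [Fintype b]

theorem isPPTOperation_testAndPrepare (hd : 0 < d) (hσ : IsState σ) (hτ : IsState τ)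
    (hlower : (((d : ℝ) - 1) • partialTranspose a b τ + partialTranspose a b σ).PosSemidef)
    (hupper : (((d : ℝ) + 1) • partialTranspose a b τ - partialTranspose a b σ).PosSemidef) :
    IsPPTOperation (testAndPrepare d σ τ) where
  completelyPositive :=
    (isCompletelyPositive_measurePrepare (posSemidef_maxEntangled hd) hσ.posSemidef).add
      (isCompletelyPositive_measurePrepare (posSemidef_one_sub_maxEntangled hd) hτ.posSemidef)
  tracePreserving X := by
    rw [testAndPrepare, LinearMap.add_apply, measurePrepare_apply, measurePrepare_apply,
      Matrix.trace_add, Matrix.trace_smul, Matrix.trace_smul, hσ.trace_eq_one, hτ.trace_eq_one,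
      sub_mul, one_mul, Matrix.trace_sub, smul_eq_mul, smul_eq_mul, mul_one, mul_one,
      add_sub_cancel]
  ppt := by
    have hF := isHermitian_swapMatrix (Fin d)
    have hFF := swapMatrix_mul_self (Fin d)
    have hc : (0 : ℝ) ≤ (2 * d : ℝ)⁻¹ := by positivity
    rw [partialTranspose_comp_testAndPrepare hd]
    exact (isCompletelyPositive_measurePrepare (posSemidef_one_add_of_mul_self_eq_one hF hFF)
      (hlower.smul hc)).add (isCompletelyPositive_measurePrepare
        (posSemidef_one_sub_of_mul_self_eq_one hF hFF) (hupper.smul hc))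

variable [DecidableEq a] [DecidableEq b]

theorem exists_isPPTOperation_maxEntangled (hσ : IsState σ) (hbin : (binegativity σ).PosSemidef)
    (hd : traceNorm (partialTranspose a b σ) + 1 ≤ d) :
    ∃ Ψ : Matrix (Fin d × Fin d) (Fin d × Fin d) ℂ →ₗ[ℂ] Matrix (a × b) (a × b) ℂ,
      IsPPTOperation Ψ ∧ Ψ (maxEntangled d) = σ := by
  set X := partialTranspose a b σ
  set t := traceNorm X
  have htpos : 0 < t := zero_lt_one.trans_le hσ.one_le_traceNorm_partialTranspose
  have hdpos : 0 < d := Nat.cast_pos.1 ((add_pos htpos one_pos).trans_le hd)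
  have hXherm : X.IsHermitian := isHermitian_partialTranspose hσ.posSemidef.isHermitian
  have hτ : IsState (t⁻¹ • binegativity σ) := by
    refine ⟨hbin.smul (inv_nonneg.2 htpos.le), ?_⟩
    rw [Matrix.trace_smul, trace_binegativity, Complex.real_smul, ← Complex.ofReal_mul,
      inv_mul_cancel₀ htpos.ne', Complex.ofReal_one]
  have hτX (c : ℝ) : c • partialTranspose a b (t⁻¹ • binegativity σ) = (c / t) • CFC.abs X := by
    rw [LinearMap.map_smul_of_tower, binegativity, partialTranspose_partialTranspose, smul_smul,
      div_eq_mul_inv]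
  refine ⟨_, isPPTOperation_testAndPrepare hdpos hσ hτ ?_ ?_, testAndPrepare_maxEntangled hdpos _ _⟩
  · rw [hτX]
    exact posSemidef_smul_abs_add hXherm ((one_le_div htpos).2 (by linarith))
  · rw [hτX]
    exact posSemidef_smul_abs_sub hXherm ((one_le_div htpos).2 (by linarith))

theorem eventually_natCeil_pow_add_one_le_pow {s t : ℝ} (ht : 1 ≤ t) (hts : t < s) :
    ∀ᶠ n : ℕ in Filter.atTop, (⌈t ^ n⌉₊ + 1 : ℝ) ≤ s ^ n := by
  have htpos : 0 < t := zero_lt_one.trans_le ht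
  have hratio : 1 < s / t := (one_lt_div htpos).2 hts
  filter_upwards [(tendsto_pow_atTop_atTop_of_one_lt hratio).eventually_ge_atTop 3] with n hn
  rw [div_pow, le_div_iff₀ (pow_pos htpos n)] at hn
  have hceil := Nat.ceil_lt_add_one (pow_pos htpos n).le
  linarith [one_le_pow₀ (n := n) ht]

theorem IsState.isAchievableRate_of_logNegativity_lt (hρ : IsState ρ)
    (hbin : (binegativity ρ).PosSemidef) {r : ℝ} (hr : logNegativity ρ < r) :
    IsAchievableRate ρ r := by
  have ht := hρ.one_le_traceNorm_partialTranspose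
  rw [logNegativity_eq_logb_traceNorm,
    Real.logb_lt_iff_lt_rpow one_lt_two (zero_lt_one.trans_le ht)] at hr
  filter_upwards [eventually_natCeil_pow_add_one_le_pow ht hr] with n hn
  refine ⟨⌈traceNorm (partialTranspose a b ρ) ^ n⌉₊ + 1, Nat.succ_pos _, ?_,
    exists_isPPTOperation_maxEntangled (hρ.tensorPower n) ?_ ?_⟩
  · rw [Real.logb_le_iff_le_rpow one_lt_two (by positivity), Real.rpow_mul_natCast zero_le_two]
    exact_mod_cast hn
  · rw [binegativity_tensorPower]
    exact posSemidef_tensorPower hbin n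
  · rw [partialTranspose_tensorPower, traceNorm_tensorPower, Nat.cast_add_one]
    gcongr
    exact Nat.le_ceil _

end UpperBound

end PairingState

theorem mainTheorem7_general {a b : Type*} [Fintype a] [DecidableEq a] [Fintype b] [DecidableEq b]
    (ρ : Matrix (a × b) (a × b) ℂ) (hρ : PairingState.IsState ρ)
    (hbin : (PairingState.binegativity ρ).PosSemidef) :
    PairingState.exactPPTCost ρ = ((PairingState.logNegativity ρ : ℝ) : EReal) := by
  refine le_antisymm (EReal.le_of_forall_lt_iff_le.1 fun r hr => ?_) (le_sInf ?_)
  · have hachievable : PairingState.IsAchievableRate ρ r :=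
      hρ.isAchievableRate_of_logNegativity_lt hbin (EReal.coe_lt_coe_iff.1 hr)
    exact sInf_le ⟨r, hachievable, rfl⟩
  · rintro _ ⟨r, hr, rfl⟩
    exact EReal.coe_le_coe_iff.2 (hρ.logNegativity_le_of_isAchievableRate hr)

theorem mainTheorem7 {a b : Type*} [Fintype a] [DecidableEq a] [Fintype b] [DecidableEq b]
    (ρ : Matrix (a × b) (a × b) ℂ) (hρ : PairingState.IsPairingState ρ) :
    PairingState.exactPPTCost ρ = ((PairingState.logNegativity ρ : ℝ) : EReal) :=
  mainTheorem7_general ρ hρ.1 hρ.posSemidef_binegativity
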